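/- Let $G=(V(G),E(G))$ be a connected, finite or countably infinite, simple undirected graph whose vertex degrees $d(v)$ are bounded; put $d(G)=\sup_v d(v)$ and $\Omega_G=\sqrt{1+1/d(G)}$. Let $L_2(G)$ be the Hilbert space of square-summable functions $f:V(G)\to\mathbb C$, and let $\mathcal L$ be the bounded self-adjoint operator $$\mathcal Lf(v)=\frac1{\sqrt{d(v)}}\sum_{u\sim v}\Big(\frac{f(v)}{\sqrt{d(v)}}-\frac{f(u)}{\sqrt{d(u)}}\Big)$$ on $L_2(G)$, with $\omega_{\min}=\inf\sigma(\mathcal L)$. For $\omega\ge 0$ let $PW_\omega(G)$ be the space of all $f\in L_2(G)$ whose transform in the spectral representation of $\mathcal L$ is supported in $[0,\omega]$. A set $U\subset V(G)$ is a uniqueness set for $PW_\omega(G)$ if any two functions in $PW_\omega(G)$ that coincide on $U$ are equal. For a finite set $S\subset V(G)$ let $bS$ be the set of vertices outside $S$ that are adjacent to a vertex of $S$. Let $\Gamma(S)$ be the graph obtained from two copies of the subgraph induced on $S\cup bS$ by identifying the two copies of each vertex of $bS$; the edges of both copies are kept, so that an edge inside $bS$ becomes a double edge. Let $\lambda_1(\Gamma(S))$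 be the first positive eigenvalue of the normalized Laplacian of $\Gamma(S)$. Let $\omega_{\min}<\omega<\Omega_G$ and let $S=\bigcup_j S_j$ be a union of finitely or infinitely many finite sets $S_j\subset V(G)$ with non-empty boundary $bS_j$, such that $\lambda_1(\Gamma(S_j))>\omega$ for every $j$ and the sets $S_j\cup bS_j$ are pairwise disjoint. Put $U=V(G)\setminus S$. Then: 1. $U$ is a uniqueness set for $PW_\omega(G)$. 2. If moreover $\inf_j\lambda_1(\Gamma(S_j))>\omega$ (which is automatic for finitely many $S_j$) or $PW_\omega(G)$ is finite-dimensional, then there is a frame $\{\Theta_u\}_{u\in U}$ in the Hilbert space $PW_\omega(G)$ such that $$f(v)=\sum_{u\in U}f(u)\,\Theta_u(v)\qquad\text{for all } f\in PW_\omega(G),\ v\in V(G).$$ Here a frame in a Hilbert space $H$ is a family $\{h_j\}$ for which there are $0<A<B$ with $A\sum_j|\langle f,h_j\rangle|^2\le\|f\|^2\le B\sum_j|\langle f,h_j\rangle|^2$ for all $f\in H$. -/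

import Mathlib

open scoped ENNReal

noncomputable section

namespace GraphPW

/-! ### Hilbert space notions -/

section Hilbert

variable {H : Type*} [NormedAddCommGroup H] [InnerProductSpace ℂ H]

/-- A family `h` of vectors of an inner product space `H` is a frame if there are constants
`0 < A < B` with `A ∑ |⟨f, h j⟩|² ≤ ‖f‖² ≤ B ∑ |⟨f, h j⟩|²` for all `f`, the series being
convergent. -/
def IsFrame {ι : Type*} (h : ι → H) : Prop :=
  ∃ A B : ℝ, 0 < A ∧ A < B ∧ ∀ f : H,
    Summable (fun j => ‖inner ℂ (h j) f‖ ^ 2) ∧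
    A * ∑' j, ‖inner ℂ (h j) f‖ ^ 2 ≤ ‖f‖ ^ 2 ∧
    ‖f‖ ^ 2 ≤ B * ∑' j, ‖inner ℂ (h j) f‖ ^ 2

/-- For a bounded self-adjoint operator `T` and a closed set `K` of reals, the space of all vectors
whose spectral support with respect to `T` lies in `K`: in a spectral representation, where `T`
becomes multiplication by `τ`, these are the vectors whose transform is supported in `K`, that is,
vanishes after multiplication by any continuous function `φ(τ)` that is zero on `K`. -/
def spectralSubspace [CompleteSpace H] (T : H →L[ℂ] H) (K : Set ℝ) : Submodule ℂ H where
  carrier := {f | ∀ φ : ℝ → ℝ, Continuous φ → (∀ τ ∈ K, φ τ = 0) → cfc φ T f = 0}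
  zero_mem' := fun φ _ _ => map_zero _
  add_mem' := fun {f g} hf hg φ hc h0 => by
    rw [map_add, hf φ hc h0, hg φ hc h0, add_zero]
  smul_mem' := fun c f hf φ hc h0 => by
    rw [map_smul, hf φ hc h0, smul_zero]

end Hilbert

/-! ### The Laplacian of a graph and its Paley-Wiener spaces -/

/-- The Hilbert space of square summable complex functions on the vertex set. -/
abbrev L2 (V : Type*) : Type _ := lp (fun _ : V => ℂ) 2

section Graph

variable {V : Type*} (G : SimpleGraph V) [G.LocallyFinite]

/-- The normalized Laplacian
`(L f)(v) = d(v)^{-1/2} ∑_{u ∼ v} (f(v) d(v)^{-1/2} - f(u) d(u)^{-1/2})` on functions. -/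
def lapFun (f : V → ℂ) (v : V) : ℂ :=
  (1 / (Real.sqrt (G.degree v) : ℂ)) * ∑ u ∈ G.neighborFinset v,
    (f v / (Real.sqrt (G.degree v) : ℂ) - f u / (Real.sqrt (G.degree u) : ℂ))

theorem lapFun_norm_sq_le (f : V → ℂ) (v : V) :
    ‖lapFun G f v‖ ^ 2 ≤
      2 * ‖f v‖ ^ 2 + 2 * ∑ u ∈ G.neighborFinset v, ‖f u‖ ^ 2 / G.degree u := by
  have hcs : ‖∑ u ∈ G.neighborFinset v,
      (f v / (Real.sqrt (G.degree v) : ℂ) - f u / (Real.sqrt (G.degree u) : ℂ))‖ ^ 2 ≤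
      G.degree v * ∑ u ∈ G.neighborFinset v,
        (2 * (‖f v‖ ^ 2 / G.degree v) + 2 * (‖f u‖ ^ 2 / G.degree u)) := by
    calc _ ≤ (∑ u ∈ G.neighborFinset v,
        ‖f v / (Real.sqrt (G.degree v) : ℂ) - f u / (Real.sqrt (G.degree u) : ℂ)‖) ^ 2 := by
          gcongr
          exact norm_sum_le _ _
      _ ≤ (G.neighborFinset v).card * ∑ u ∈ G.neighborFinset v,
        ‖f v / (Real.sqrt (G.degree v) : ℂ) - f u / (Real.sqrt (G.degree u) : ℂ)‖ ^ 2 :=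
          sq_sum_le_card_mul_sum_sq
      _ ≤ _ := by
          rw [SimpleGraph.card_neighborFinset_eq_degree]
          gcongr with u hu
          have e : ∀ w : V, ‖f w / (Real.sqrt (G.degree w) : ℂ)‖ ^ 2 =
              ‖f w‖ ^ 2 / G.degree w := by
            intro w
            rw [norm_div, div_pow, Complex.norm_real, Real.norm_eq_abs, sq_abs,
              Real.sq_sqrt (Nat.cast_nonneg _)]
          rw [← e v, ← e u]
          have h1 := norm_sub_le (f v / (Real.sqrt (G.degree v) : ℂ))
            (f u / (Real.sqrt (G.degree u) : ℂ))
          have h2 := norm_nonneg (f v / (Real.sqrt (G.degree v) : ℂ) -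
            f u / (Real.sqrt (G.degree u) : ℂ))
          nlinarith [sq_nonneg (‖f v / (Real.sqrt (G.degree v) : ℂ)‖ -
            ‖f u / (Real.sqrt (G.degree u) : ℂ)‖)]
  rw [lapFun, norm_mul, mul_pow, norm_div, norm_one, Complex.norm_real, Real.norm_eq_abs, div_pow,
    sq_abs, Real.sq_sqrt (Nat.cast_nonneg _), one_pow]
  rw [Finset.sum_add_distrib, Finset.sum_const, SimpleGraph.card_neighborFinset_eq_degree,
    ← Finset.mul_sum, nsmul_eq_mul] at hcs
  have hS : 0 ≤ ∑ u ∈ G.neighborFinset v, ‖f u‖ ^ 2 / (G.degree u : ℝ) :=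
    Finset.sum_nonneg fun u _ => by positivity
  rcases Nat.eq_zero_or_pos (G.degree v) with h | h
  · rw [h]
    simp only [Nat.cast_zero, div_zero, zero_mul]
    positivity
  · have hd : (0 : ℝ) < G.degree v := Nat.cast_pos.mpr h
    rw [div_mul_eq_mul_div, one_mul, div_le_iff₀ hd]
    refine hcs.trans (le_of_eq ?_)
    field_simp

theorem sum_lapFun_norm_sq_le (f : L2 V) (s : Finset V) :
    ∑ v ∈ s, ‖lapFun G f v‖ ^ 2 ≤ (2 * ‖f‖) ^ 2 := by
  classical
  have hf : ∀ t : Finset V, ∑ v ∈ t, ‖f v‖ ^ 2 ≤ ‖f‖ ^ 2 := fun t => by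
    have := lp.sum_rpow_le_norm_rpow (p := 2) (by norm_num) f t
    simpa using this
  have hswap : ∑ v ∈ s, ∑ u ∈ G.neighborFinset v, ‖f u‖ ^ 2 / (G.degree u : ℝ) ≤ ‖f‖ ^ 2 := by
    set t := s.biUnion fun v => G.neighborFinset v with ht
    calc ∑ v ∈ s, ∑ u ∈ G.neighborFinset v, ‖f u‖ ^ 2 / (G.degree u : ℝ)
        = ∑ u ∈ t, ∑ v ∈ s with G.Adj u v, ‖f u‖ ^ 2 / (G.degree u : ℝ) := by
          apply Finset.sum_comm'
          intro v u
          simp only [ht, SimpleGraph.mem_neighborFinset, Finset.mem_filter, Finset.mem_biUnion]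
          constructor
          · rintro ⟨h1, h2⟩
            exact ⟨⟨h1, h2.symm⟩, v, h1, h2⟩
          · rintro ⟨⟨h1, h2⟩, -⟩
            exact ⟨h1, h2.symm⟩
      _ ≤ ∑ u ∈ t, ‖f u‖ ^ 2 := by
          gcongr with u hu
          rw [Finset.sum_const, nsmul_eq_mul]
          have hc : ((s.filter fun v => G.Adj u v).card : ℝ) ≤ G.degree u := by
            rw [← SimpleGraph.card_neighborFinset_eq_degree]
            refine Nat.cast_le.mpr (Finset.card_le_card fun v hv => ?_)
            simpa using (Finset.mem_filter.mp hv).2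
          rcases Nat.eq_zero_or_pos (G.degree u) with h | h
          · rw [h]
            simp only [Nat.cast_zero, div_zero, mul_zero]
            positivity
          · have hd : (0 : ℝ) < G.degree u := Nat.cast_pos.mpr h
            rw [mul_div_assoc', div_le_iff₀ hd, mul_comm]
            gcongr
      _ ≤ ‖f‖ ^ 2 := hf t
  calc ∑ v ∈ s, ‖lapFun G f v‖ ^ 2
      ≤ ∑ v ∈ s, (2 * ‖f v‖ ^ 2 +
          2 * ∑ u ∈ G.neighborFinset v, ‖f u‖ ^ 2 / (G.degree u : ℝ)) :=
        Finset.sum_le_sum fun v _ => lapFun_norm_sq_le G f v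
    _ ≤ (2 * ‖f‖) ^ 2 := by
        rw [Finset.sum_add_distrib, ← Finset.mul_sum, ← Finset.mul_sum]
        nlinarith [hf s]

/-- The Laplacian as a linear map on `L2 V`. -/
def lapLin : L2 V →ₗ[ℂ] L2 V where
  toFun f := ⟨lapFun G f, memℓp_gen' (C := (2 * ‖f‖) ^ 2) fun s => by
    simpa using sum_lapFun_norm_sq_le G f s⟩
  map_add' f g := by
    ext v
    simp only [lapFun, lp.coeFn_add, Pi.add_apply, ← mul_add, ← Finset.sum_add_distrib]
    congr 1
    exact Finset.sum_congr rfl fun u _ => by ring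
  map_smul' c f := by
    ext v
    simp only [lapFun, lp.coeFn_smul, Pi.smul_apply, smul_eq_mul, RingHom.id_apply]
    rw [mul_left_comm]
    congr 1
    rw [Finset.mul_sum]
    exact Finset.sum_congr rfl fun u _ => by ring

/-- The Laplacian as a bounded operator on `L2 V`. -/
def lap : L2 V →L[ℂ] L2 V :=
  (lapLin G).mkContinuous 2 fun f =>
    lp.norm_le_of_forall_sum_le (by norm_num) (by positivity) fun s => by
      have h : ∀ v, lapLin G f v = lapFun G f v := fun _ => rfl
      simpa [h] using sum_lapFun_norm_sq_le G f s

theorem lap_apply (f : L2 V) (v : V) :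
    lap G f v = (1 / (Real.sqrt (G.degree v) : ℂ)) * ∑ u ∈ G.neighborFinset v,
      (f v / (Real.sqrt (G.degree v) : ℂ) - f u / (Real.sqrt (G.degree u) : ℂ)) := rfl

theorem lap_isSelfAdjoint : IsSelfAdjoint (lap G) := by
  classical
  have key : ∀ (f : L2 V) (v : V),
      inner ℂ (lap G (lp.single 2 v (1 : ℂ))) f = lap G f v := by
    intro f v
    have hself : lap G (lp.single 2 v (1 : ℂ)) v =
        (1 / (Real.sqrt (G.degree v) : ℂ)) * ∑ u ∈ G.neighborFinset v,
          (1 / (Real.sqrt (G.degree v) : ℂ)) := by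
      rw [lap_apply]
      congr 1
      refine Finset.sum_congr rfl fun u hu => ?_
      have hne : u ≠ v := ((G.mem_neighborFinset v u).mp hu).ne'
      simp [lp.single_apply, hne]
    have hadj : ∀ w, G.Adj v w → lap G (lp.single 2 v (1 : ℂ)) w =
        -((1 / (Real.sqrt (G.degree w) : ℂ)) * (1 / (Real.sqrt (G.degree v) : ℂ))) := by
      intro w hw
      rw [lap_apply, ← mul_neg]
      congr 1
      rw [Finset.sum_eq_single v]
      · simp [lp.single_apply, hw.ne']
      · intro u _ hu
        simp [lp.single_apply, hu, hw.ne']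
      · intro h
        exact absurd ((G.mem_neighborFinset w v).mpr hw.symm) h
    have hout : ∀ w ∉ insert v (G.neighborFinset v), lap G (lp.single 2 v (1 : ℂ)) w = 0 := by
      intro w hw
      rw [Finset.mem_insert, SimpleGraph.mem_neighborFinset, not_or] at hw
      rw [lap_apply, Finset.sum_eq_zero, mul_zero]
      intro u hu
      have hne : u ≠ v := by
        rintro rfl
        exact hw.2 ((G.mem_neighborFinset w u).mp hu).symm
      simp [lp.single_apply, hw.1, hne]
    have hsum : ∑ w ∈ G.neighborFinset v, inner ℂ (lap G (lp.single 2 v (1 : ℂ)) w) (f w) =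
        -((1 / (Real.sqrt (G.degree v) : ℂ)) *
          ∑ w ∈ G.neighborFinset v, f w / (Real.sqrt (G.degree w) : ℂ)) := by
      rw [Finset.mul_sum, ← Finset.sum_neg_distrib]
      refine Finset.sum_congr rfl fun w hw => ?_
      rw [hadj w ((G.mem_neighborFinset v w).mp hw)]
      simp
      ring
    rw [lp.inner_eq_tsum, tsum_eq_sum (s := insert v (G.neighborFinset v)),
      Finset.sum_insert (by simp), hself, hsum, lap_apply, Finset.sum_sub_distrib, mul_sub,
      sub_eq_add_neg]
    · congr 1
      simp
      ring
    · intro w hw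
      rw [hout w hw, inner_zero_left]
  rw [ContinuousLinearMap.isSelfAdjoint_iff']
  ext f v
  rw [← key, ← ContinuousLinearMap.adjoint_inner_right, lp.inner_single_left]
  simp

/-- The infimum of the spectrum of the Laplacian. -/
def omegaMin : ℝ := sInf (spectrum ℝ (lap G))

/-- The supremum of the vertex degrees. -/
def maxDeg : ℕ := ⨆ v, G.degree v

/-- The constant `Ω_G = √(1 + 1 / d(G))`. -/
def OmegaG : ℝ := Real.sqrt (1 + 1 / (maxDeg G : ℝ))

/-- The Paley-Wiener space: functions in `L2 V` whose transform in the spectral representation of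
the Laplacian is supported in `[0, ω]`. -/
def PW (ω : ℝ) : Submodule ℂ (L2 V) := spectralSubspace (lap G) (Set.Icc 0 ω)

/-- `U` is a uniqueness set for the Paley-Wiener space of type `ω`. -/
def IsUniquenessSet (U : Set V) (ω : ℝ) : Prop :=
  ∀ f ∈ PW G ω, ∀ g ∈ PW G ω, (∀ u ∈ U, f u = g u) → f = g

end Graph

/-! ### Vertex boundaries and the doubled graph -/

section Doubled

variable {V : Type*} (G : SimpleGraph V)

/-- The vertex boundary of `S`: vertices outside `S` that are adjacent to a vertex of `S`. -/
def vertexBoundary (S : Set V) : Set V := {v | v ∉ S ∧ ∃ u ∈ S, G.Adj u v}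

/-- `S` together with its vertex boundary. -/
def vertexClosure (S : Set V) : Set V := S ∪ vertexBoundary G S

theorem vertexBoundary_finite [G.LocallyFinite] (S : Finset V) :
    (vertexBoundary G (S : Set V)).Finite := by
  refine (S.finite_toSet.biUnion fun u _ => (G.neighborFinset u).finite_toSet).subset ?_
  rintro v ⟨-, u, hu, huv⟩
  exact Set.mem_biUnion hu (by simpa using huv)

/-- Vertices of the doubled graph `Γ(S)`: two copies of `S ∪ bS` glued along `bS`, that is, two
copies `(v, i)` of each vertex `v` of `S` and a single copy of each vertex of `bS`. -/
abbrev DoubledVertex (S : Set V) : Type _ := (S × Bool) ⊕ (vertexBoundary G S)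

instance [G.LocallyFinite] (S : Finset V) : Finite (DoubledVertex G (S : Set V)) :=
  haveI := (vertexBoundary_finite G S).to_subtype
  inferInstance

instance [G.LocallyFinite] (S : Finset V) : Fintype (DoubledVertex G (S : Set V)) :=
  Fintype.ofFinite _

variable {G}

/-- The vertex of `G` under a vertex of the doubled graph. -/
def DoubledVertex.base {S : Set V} : DoubledVertex G S → V
  | .inl x => x.1
  | .inr x => x

/-- The vertex `x` of the doubled graph lies in the `i`-th copy of `S ∪ bS`. -/
def DoubledVertex.InCopy {S : Set V} (i : Bool) : DoubledVertex G S → Prop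
  | .inl x => x.2 = i
  | .inr _ => True

variable (G)

/-- The number of edges of the doubled graph between `x` and `y`: one for each of the two copies of
the induced graph on `S ∪ bS` in which `x` and `y` are adjacent. So every boundary vertex has twice
the degree in `Γ(S)` that it has in the induced graph. -/
def edgeMult (S : Set V) (x y : DoubledVertex G S) : ℕ :=
  Nat.card {i : Bool // DoubledVertex.InCopy i x ∧ DoubledVertex.InCopy i y ∧
    G.Adj (DoubledVertex.base x) (DoubledVertex.base y)}

/-- The normalized Laplacian of a finite graph given by its edge multiplicities `m`. -/
def multiLap {W : Type*} [Fintype W] (m : W → W → ℕ) : (W → ℂ) →ₗ[ℂ] (W → ℂ) where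
  toFun f x := (1 / (Real.sqrt (∑ z, m x z : ℕ) : ℂ)) * ∑ y, (m x y : ℂ) *
    (f x / (Real.sqrt (∑ z, m x z : ℕ) : ℂ) - f y / (Real.sqrt (∑ z, m y z : ℕ) : ℂ))
  map_add' f g := by
    ext x
    simp only [Pi.add_apply, ← mul_add, ← Finset.sum_add_distrib]
    congr 1
    exact Finset.sum_congr rfl fun u _ => by ring
  map_smul' c f := by
    ext x
    simp only [Pi.smul_apply, smul_eq_mul, RingHom.id_apply]
    rw [mul_left_comm]
    congr 1
    rw [Finset.mul_sum]
    exact Finset.sum_congr rfl fun u _ => by ring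

/-- The first positive eigenvalue of the normalized Laplacian of the doubled graph `Γ(S)` of a
finite set `S` of vertices. -/
def lambdaOne [G.LocallyFinite] (S : Finset V) : ℝ :=
  sInf {t : ℝ | 0 < t ∧ Module.End.HasEigenvalue (multiLap (edgeMult G (S : Set V))) (t : ℂ)}

end Doubled

end GraphPW

end

open scoped ENNReal

noncomputable section

namespace GraphPW

/-! ### Energy bound for spectral subspaces -/

section Spectral

variable {H : Type*} [NormedAddCommGroup H] [InnerProductSpace ℂ H] [CompleteSpace H]

/-! Two bounds on the energy `⟨Lf, f⟩` collide. A function in `PW G ω` satisfies `⟨Lf, f⟩ ≤ ω‖f‖²`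
(`re_inner_le_of_mem_spectralSubspace`). A function supported on a finite `S` with non-empty
boundary satisfies `⟨Lf, f⟩ ≥ λ₁(Γ(S))‖f‖²` (`lambdaOne_mul_norm_sq_le`): the right constant is the
least Dirichlet eigenvalue of `S`, and a Dirichlet eigenfunction, taken with opposite signs on the
two copies of `S` and zero on `bS`, is an eigenfunction of `Γ(S)` with the same eigenvalue
(`multiLap_oddExtension`). That eigenvalue is positive by a maximum principle, so it is at least
`λ₁(Γ(S))`.

Because the sets `S_j ∪ bS_j` are disjoint, the energy of a function supported on their interiors is
the sum of the local energies. A nonzero function of `PW G ω` vanishing on `U` would then have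
energy both at most and strictly above `ω‖f‖²`, which gives uniqueness.

For the frame it suffices that restriction `PW G ω → ℓ²(U)` be bounded below. In finite dimension
this follows from injectivity; with a uniform gap, `norm_le_of_mem_PW` makes the uniqueness argument
quantitative. A bounded left inverse of the restriction then sends the standard basis of `ℓ²(U)` to
the frame (`exists_frame_of_antilipschitz`). -/

theorem isClosed_spectralSubspace (T : H →L[ℂ] H) (K : Set ℝ) :
    IsClosed (spectralSubspace T K : Set H) := by
  have : (spectralSubspace T K : Set H) =
      ⋂ (φ : ℝ → ℝ) (_ : Continuous φ) (_ : ∀ τ ∈ K, φ τ = 0), {f | cfc φ T f = 0} := by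
    ext f
    simp only [Set.mem_iInter]
    rfl
  rw [this]
  exact isClosed_iInter fun φ => isClosed_iInter fun _ => isClosed_iInter fun _ =>
    isClosed_eq (cfc φ T).continuous continuous_const

theorem re_inner_le_of_mem_spectralSubspace {T : H →L[ℂ] H} (hT : IsSelfAdjoint T) {a ω : ℝ}
    {f : H} (hf : f ∈ spectralSubspace T (Set.Icc a ω)) :
    (inner ℂ (T f) f).re ≤ ω * ‖f‖ ^ 2 := by
  -- The positive part of `t - ω` vanishes on `[a, ω]`, so it kills `f`, and it dominates `t - ω` on
  -- the whole spectrum.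
  have hzero : cfc (fun t : ℝ => max (t - ω) 0) T f = 0 :=
    hf _ (by fun_prop) fun τ hτ => max_eq_right (by linarith [hτ.2])
  have hle : cfc (fun t : ℝ => t - ω) T ≤ cfc (fun t : ℝ => max (t - ω) 0) T :=
    cfc_mono (fun x _ => le_max_left _ _)
  have hsub : cfc (fun t : ℝ => t - ω) T = T - algebraMap ℝ (H →L[ℂ] H) ω := by
    rw [cfc_sub (fun t : ℝ => t) (fun _ => ω) T, cfc_id' ℝ T, cfc_const ω T]
  have hpos := ((ContinuousLinearMap.le_def _ _).mp hle).re_inner_nonneg_left f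
  rw [sub_apply, hzero, hsub, zero_sub, sub_apply, neg_sub, inner_sub_left,
    Algebra.algebraMap_eq_smul_one, smul_apply, one_apply_eq_self, ← Complex.coe_smul,
    inner_smul_left, inner_self_eq_norm_sq_to_K, map_sub] at hpos
  simp only [Complex.conj_ofReal, Complex.coe_algebraMap, ← Complex.ofReal_pow,
    ← Complex.ofReal_mul, RCLike.re_to_complex, Complex.ofReal_re] at hpos
  linarith

end Spectral

/-! ### Frames from operators bounded below -/

section Frame

/-- An operator bounded below has closed range: project orthogonally onto the range, then invert
there. -/
theorem exists_continuousLinearMap_leftInverse {H K : Type*} [NormedAddCommGroup H]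
    [NormedSpace ℂ H] [CompleteSpace H] [NormedAddCommGroup K] [InnerProductSpace ℂ K]
    [CompleteSpace K] (R : H →L[ℂ] K) {c : NNReal} (hR : AntilipschitzWith c R) :
    ∃ T : K →L[ℂ] H, ∀ f, T (R f) = f := by
  have hcl := hR.isClosed_range R.uniformContinuous
  let e := R.equivRange hR.injective hcl
  have : CompleteSpace (R : H →ₗ[ℂ] K).range :=
    (show IsClosed ((R : H →ₗ[ℂ] K).range : Set K) from hcl).completeSpace_coe
  refine ⟨(e.symm : _ →L[ℂ] H) ∘L (R : H →ₗ[ℂ] K).range.orthogonalProjectionOnto, fun f => ?_⟩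
  have : (R : H →ₗ[ℂ] K).range.orthogonalProjectionOnto (R f) = e f := by
    have h := Submodule.orthogonalProjectionOnto_mem_subspace_eq_self (e f)
    exact h
  simp [this]

theorem L2_hasSum_norm_sq {V : Type*} (f : L2 V) : HasSum (fun v => ‖f v‖ ^ 2) (‖f‖ ^ 2) := by
  have := lp.hasSum_norm (p := 2) (by norm_num) f
  simpa using this

/-- With `T` a left inverse of `R`, the frame is `Θ u = T e_u`. Its coefficient map is `T*`, which
is bounded, and bounded below because `R* T* = 1`. Applying `T` to the basis expansion of `R f`
gives the reconstruction. -/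
theorem exists_frame_of_antilipschitz {H : Type*} [NormedAddCommGroup H] [InnerProductSpace ℂ H]
    [CompleteSpace H] {ι : Type*} (R : H →L[ℂ] L2 ι) {c : NNReal} (hR : AntilipschitzWith c R) :
    ∃ Θ : ι → H, IsFrame Θ ∧ ∀ f, HasSum (fun u => R f u • Θ u) f := by
  classical
  obtain ⟨T, hT⟩ := exists_continuousLinearMap_leftInverse R hR
  have hinner : ∀ f u, inner ℂ (T (lp.single 2 u (1 : ℂ))) f = T.adjoint f u := by
    intro f u
    rw [← ContinuousLinearMap.adjoint_inner_right, lp.inner_single_left]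
    simp
  have hadj : ∀ f, R.adjoint (T.adjoint f) = f := by
    intro f
    refine ext_inner_left ℂ fun g => ?_
    rw [ContinuousLinearMap.adjoint_inner_right, ContinuousLinearMap.adjoint_inner_right, hT]
  refine ⟨fun u => T (lp.single 2 u (1 : ℂ)), ?_, fun f => ?_⟩
  · set a := ‖T.adjoint‖
    set b := ‖R.adjoint‖
    -- `a²` and `b²` would be the natural bounds; the added constants avoid division by zero and
    -- force `A ≤ 1 < 2 ≤ B`.
    refine ⟨1 / (a ^ 2 + 1), b ^ 2 + 2, by positivity, ?_, fun f => ?_⟩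
    · have h1 : 1 / (a ^ 2 + 1) ≤ 1 := by
        rw [div_le_one (by positivity)]
        nlinarith [sq_nonneg a]
      nlinarith [sq_nonneg b]
    · simp only [hinner]
      have hs := L2_hasSum_norm_sq (T.adjoint f)
      refine ⟨hs.summable, ?_, ?_⟩
      · rw [hs.tsum_eq, div_mul_eq_mul_div, one_mul, div_le_iff₀ (by positivity)]
        have h1 := pow_le_pow_left₀ (norm_nonneg _) (T.adjoint.le_opNorm f) 2
        rw [mul_pow] at h1
        nlinarith [sq_nonneg ‖f‖]
      · rw [hs.tsum_eq]
        have h1 := pow_le_pow_left₀ (norm_nonneg _) (R.adjoint.le_opNorm (T.adjoint f)) 2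
        rw [hadj, mul_pow] at h1
        nlinarith [sq_nonneg ‖T.adjoint f‖]
  · have h := (lp.hasSum_single (p := 2) (by norm_num) (R f)).mapL T
    rw [hT] at h
    convert h using 2 with u
    rw [← map_smul, ← lp.single_smul, smul_eq_mul, mul_one]

end Frame

/-! ### Restriction, cutoff and sums over disjoint finite sets -/

section Restrict

variable {V : Type*}

theorem L2_restrict_sum_le (A : Set V) (f : L2 V) (s : Finset A) :
    ∑ u ∈ s, ‖f u‖ ^ 2 ≤ ‖f‖ ^ 2 := by
  have h := sum_le_hasSum (s.map (Function.Embedding.subtype (· ∈ A)))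
    (fun _ _ => by positivity) (L2_hasSum_norm_sq f)
  rwa [Finset.sum_map] at h

/-- Restriction of square summable functions to a set of vertices, as a linear map. -/
def restrictLin (A : Set V) : L2 V →ₗ[ℂ] L2 A where
  toFun f := ⟨fun u => f u, memℓp_gen' (C := ‖f‖ ^ 2) fun s => by
    simpa using L2_restrict_sum_le A f s⟩
  map_add' _ _ := rfl
  map_smul' _ _ := rfl

/-- Restriction of square summable functions to a set of vertices. -/
def restrict (A : Set V) : L2 V →L[ℂ] L2 A :=
  (restrictLin A).mkContinuous 1 fun f =>
    lp.norm_le_of_forall_sum_le (by norm_num) (by positivity) fun s => by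
      have h : ∀ u, restrictLin A f u = f u := fun _ => rfl
      simpa [h] using L2_restrict_sum_le A f s

@[simp]
theorem restrict_apply (A : Set V) (f : L2 V) (u : A) : restrict A f u = f u := rfl

open Classical in
/-- The function that agrees with `f` on `A` and vanishes off `A`. -/
def cutoff (A : Set V) (f : L2 V) : L2 V :=
  ⟨fun v => if v ∈ A then f v else 0, (lp.memℓp f).mono' fun v => by
    split_ifs <;> simp⟩

theorem cutoff_of_mem {A : Set V} (f : L2 V) {v : V} (hv : v ∈ A) : cutoff A f v = f v :=
  if_pos hv

theorem cutoff_of_notMem {A : Set V} (f : L2 V) {v : V} (hv : v ∉ A) : cutoff A f v = 0 :=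
  if_neg hv

theorem norm_cutoff (A : Set V) (f : L2 V) : ‖cutoff A f‖ = ‖restrict A f‖ := by
  have h1 := L2_hasSum_norm_sq (cutoff A f)
  have h2 : HasSum (fun u : A => ‖cutoff A f u‖ ^ 2) (‖cutoff A f‖ ^ 2) :=
    (hasSum_subtype_iff_of_support_subset fun v hv => by
      by_contra hA
      simp [cutoff_of_notMem f hA] at hv).mpr h1
  have h3 := L2_hasSum_norm_sq (restrict A f)
  simp only [restrict_apply] at h3
  simp only [cutoff_of_mem f (Subtype.coe_prop _)] at h2
  exact (sq_eq_sq₀ (norm_nonneg _) (norm_nonneg _)).mp (h2.unique h3)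

theorem norm_sq_cutoff_add (A : Set V) (f : L2 V) :
    ‖f‖ ^ 2 = ‖cutoff A f‖ ^ 2 + ‖cutoff Aᶜ f‖ ^ 2 := by
  refine (L2_hasSum_norm_sq f).unique ?_
  convert (L2_hasSum_norm_sq (cutoff A f)).add (L2_hasSum_norm_sq (cutoff Aᶜ f)) using 2 with v
  by_cases hv : v ∈ A
  · simp [cutoff_of_mem f hv, cutoff_of_notMem f (show v ∉ Aᶜ by simpa using hv)]
  · simp [cutoff_of_notMem f hv, cutoff_of_mem f (show v ∈ Aᶜ from hv)]

theorem cutoff_add_cutoff_compl (A : Set V) (f : L2 V) : cutoff A f + cutoff Aᶜ f = f := by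
  ext v
  rw [lp.coeFn_add, Pi.add_apply]
  by_cases hv : v ∈ A
  · simp [cutoff_of_mem f hv, cutoff_of_notMem f (show v ∉ Aᶜ by simpa using hv)]
  · simp [cutoff_of_notMem f hv, cutoff_of_mem f (show v ∈ Aᶜ from hv)]

theorem hasSum_sum_of_pairwise_disjoint {ι : Type*} {S : ι → Finset V}
    (hS : Pairwise fun i j => Disjoint (S i) (S j)) {g : V → ℝ} {a : ℝ}
    (hg : ∀ v, v ∉ ⋃ j, (S j : Set V) → g v = 0) (h : HasSum g a) :
    HasSum (fun j => ∑ v ∈ S j, g v) a := by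
  have hS' : Pairwise (Function.onFun Disjoint fun j => (S j : Set V)) := fun i j hij =>
    Finset.disjoint_coe.mpr (hS hij)
  have h1 : HasSum (fun v : ⋃ j, (S j : Set V) => g v) a :=
    (hasSum_subtype_iff_of_support_subset fun v hv => by
      by_contra hA
      exact hv (hg v hA)).mpr h
  have h2 := ((Set.unionEqSigmaOfDisjoint hS').symm.hasSum_iff).mpr h1
  refine HasSum.sigma h2 fun j => ?_
  rw [← Finset.sum_coe_sort (S j) g]
  exact hasSum_fintype fun v : S j => g v

end Restrict
-- Dirichlet problem on a finite set and the doubled graph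
section Dirichlet

variable {V : Type*} (G : SimpleGraph V)

/-- The square summable functions that vanish off `S`. -/
def supportedOn (S : Set V) : Submodule ℂ (L2 V) where
  carrier := {f | ∀ v ∉ S, f v = 0}
  zero_mem' := fun _ _ => rfl
  add_mem' := fun {f g} hf hg v hv => by simp [hf v hv, hg v hv]
  smul_mem' := fun c f hf v hv => by simp [hf v hv]

theorem cutoff_mem_supportedOn (S : Set V) (f : L2 V) : cutoff S f ∈ supportedOn S :=
  fun _ hv => cutoff_of_notMem f hv

instance (S : Finset V) : FiniteDimensional ℂ (supportedOn (S : Set V)) := by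
  refine FiniteDimensional.of_injective (V₂ := S → ℂ)
    { toFun := fun f v => (f : L2 V) v, map_add' := fun _ _ => rfl, map_smul' := fun _ _ => rfl }
    fun f g hfg => ?_
  ext v
  by_cases hv : v ∈ S
  · exact congr_fun hfg ⟨v, hv⟩
  · rw [f.2 v hv, g.2 v hv]

theorem mem_vertexClosure_of_adj {S : Set V} {v u : V} (hv : v ∈ S) (h : G.Adj v u) :
    u ∈ vertexClosure G S := by
  by_cases hu : u ∈ S
  · exact Or.inl hu
  · exact Or.inr ⟨hu, v, hv, h⟩

theorem pairwise_disjoint_of_closures {G : SimpleGraph V} {ι : Type*} {S : ι → Finset V}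
    (hdisj : Pairwise fun i j =>
      Disjoint (vertexClosure G (S i : Set V)) (vertexClosure G (S j : Set V))) :
    Pairwise fun i j => Disjoint (S i) (S j) := fun _ _ hij =>
  Finset.disjoint_coe.mp
    ((hdisj hij).mono Set.subset_union_left Set.subset_union_left)

/-! ### The doubled graph -/

open scoped Classical in
theorem edgeMult_inl (S : Set V) (v : S) (i : Bool) (y : DoubledVertex G S) :
    edgeMult G S (.inl (v, i)) y = if DoubledVertex.InCopy i y ∧ G.Adj v y.base then 1 else 0 := by
  unfold edgeMult
  split_ifs with h
  · rw [Nat.card_eq_one_iff_unique]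
    refine ⟨⟨?_⟩, ⟨⟨i, rfl, h.1, h.2⟩⟩⟩
    rintro ⟨j, hj, -⟩ ⟨k, hk, -⟩
    exact Subtype.ext ((show i = j from hj).symm.trans hk)
  · rw [Nat.card_eq_zero]
    refine Or.inl ⟨?_⟩
    rintro ⟨j, hj, h1, h2⟩
    obtain rfl : i = j := hj
    exact h ⟨h1, h2⟩

theorem DoubledVertex.base_injOn (S : Set V) (i : Bool) :
    Set.InjOn (DoubledVertex.base (G := G) (S := S)) {x | DoubledVertex.InCopy i x} := by
  rintro (⟨x, j⟩ | x) hx (⟨y, k⟩ | y) hy hxy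
  · obtain rfl : j = i := hx
    obtain rfl : k = j := hy
    obtain rfl : x = y := Subtype.ext hxy
    rfl
  · exact absurd (show (y : V) ∈ S from (show (x : V) = y from hxy) ▸ x.2) y.2.1
  · exact absurd (show (x : V) ∈ S from (show (x : V) = y from hxy) ▸ y.2) x.2.1
  · obtain rfl : x = y := Subtype.ext hxy
    rfl

theorem DoubledVertex.exists_base_eq {S : Set V} (i : Bool) {v : V}
    (hv : v ∈ vertexClosure G S) :
    ∃ x : DoubledVertex G S, DoubledVertex.InCopy i x ∧ x.base = v := by
  rcases hv with hv | hv
  · exact ⟨.inl (⟨v, hv⟩, i), rfl, rfl⟩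
  · exact ⟨.inr ⟨v, hv⟩, trivial, rfl⟩

/-- All `G`-neighbours of a vertex of `S` lie in `S ∪ bS`, so projection to `G` maps the neighbours
of `(v, i)` bijectively onto those of `v`. Hence the Laplacian of `Γ(S)` at `(v, i)` can be compared
with that of `G` at `v`. -/
theorem sum_edgeMult_inl [G.LocallyFinite] (S : Set V) [Fintype (DoubledVertex G S)] (v : S)
    (i : Bool) {R : Type*} [CommSemiring R] (h : DoubledVertex G S → R) (k : V → R)
    (hk : ∀ y, DoubledVertex.InCopy i y → h y = k y.base) :
    ∑ y, (edgeMult G S (.inl (v, i)) y : R) * h y = ∑ u ∈ G.neighborFinset v, k u := by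
  classical
  simp only [edgeMult_inl, Nat.cast_ite, Nat.cast_one, Nat.cast_zero, ite_mul, one_mul, zero_mul]
  rw [← Finset.sum_filter]
  refine Finset.sum_bij (fun y _ => y.base) ?_ ?_ ?_ ?_
  · intro y hy
    simpa using (Finset.mem_filter.mp hy).2.2
  · intro x hx y hy hxy
    exact DoubledVertex.base_injOn G S i (Finset.mem_filter.mp hx).2.1
      (Finset.mem_filter.mp hy).2.1 hxy
  · intro u hu
    rw [SimpleGraph.mem_neighborFinset] at hu
    obtain ⟨x, hx, rfl⟩ := DoubledVertex.exists_base_eq G i (mem_vertexClosure_of_adj G v.2 hu)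
    exact ⟨x, by simp [hx, hu], rfl⟩
  · intro y hy
    exact hk y (Finset.mem_filter.mp hy).2.1

theorem sum_edgeMult_inl_eq_degree [G.LocallyFinite] (S : Set V) [Fintype (DoubledVertex G S)]
    (v : S) (i : Bool) : ∑ y, edgeMult G S (.inl (v, i)) y = G.degree v := by
  have := sum_edgeMult_inl G S v i (R := ℕ) (fun _ => 1) (fun _ => 1) fun _ _ => rfl
  simpa using this

/-- The involution of the doubled graph that exchanges the two copies. -/
def swapCopies (S : Set V) : DoubledVertex G S ≃ DoubledVertex G S :=
  Equiv.sumCongr (Equiv.prodCongr (Equiv.refl _) Equiv.boolNot) (Equiv.refl _)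

theorem edgeMult_inr_swapCopies (S : Set V) (b : vertexBoundary G S) (y : DoubledVertex G S) :
    edgeMult G S (.inr b) (swapCopies G S y) = edgeMult G S (.inr b) y := by
  refine Nat.card_congr (Equiv.boolNot.subtypeEquiv fun i => ?_)
  rcases y with ⟨x, j⟩ | y
  · cases i <;> cases j <;>
      simp [DoubledVertex.InCopy, swapCopies, DoubledVertex.base]
  · simp [DoubledVertex.InCopy, swapCopies, DoubledVertex.base]

/-- The sign that distinguishes the two copies. -/
def copySign (i : Bool) : ℂ := if i then 1 else -1

/-- The extension of a function on `S` to the doubled graph that is odd under exchange of the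
copies. -/
def oddExtension (S : Set V) (f : V → ℂ) : DoubledVertex G S → ℂ
  | .inl x => copySign x.2 * f x.1
  | .inr _ => 0

/-- On a copy of `S` the two Laplacians agree up to the sign of the copy. At a boundary vertex the
contributions of the two copies cancel. -/
theorem multiLap_oddExtension [G.LocallyFinite] (S : Set V) [Fintype (DoubledVertex G S)]
    (f : V → ℂ) (hf : ∀ v ∉ S, f v = 0) (t : ℂ) (ht : ∀ v ∈ S, lapFun G f v = t * f v) :
    multiLap (edgeMult G S) (oddExtension G S f) = t • oddExtension G S f := by
  ext x
  simp only [multiLap, LinearMap.coe_mk, AddHom.coe_mk, Pi.smul_apply, smul_eq_mul]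
  rcases x with ⟨v, i⟩ | b
  · rw [sum_edgeMult_inl_eq_degree, sum_edgeMult_inl G S v i _
      (fun u => copySign i * (f v / (Real.sqrt (G.degree v) : ℂ) -
        f u / (Real.sqrt (G.degree u) : ℂ)))]
    · rw [← Finset.mul_sum, mul_left_comm]
      change copySign i * lapFun G f v = t * (copySign i * f v)
      rw [ht v v.2]
      ring
    · rintro (⟨y, j⟩ | y) hy
      · obtain rfl : j = i := hy
        rw [sum_edgeMult_inl_eq_degree]
        change copySign j * f v / (Real.sqrt (G.degree v) : ℂ) -
          copySign j * f y / (Real.sqrt (G.degree y) : ℂ) = copySign j *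
            (f v / (Real.sqrt (G.degree v) : ℂ) - f y / (Real.sqrt (G.degree y) : ℂ))
        ring
      · simp only [oddExtension, DoubledVertex.base, hf _ y.2.1]
        ring
  · have hodd : ∀ y, oddExtension G S f (swapCopies G S y) = -oddExtension G S f y := by
      rintro (⟨y, j⟩ | y)
      · cases j <;> simp [oddExtension, swapCopies, copySign]
      · simp [oddExtension, swapCopies]
    -- Degrees at boundary vertices never matter, since the function vanishes there.
    have hdeg : ∀ y, oddExtension G S f y = 0 ∨
        ∑ z, edgeMult G S (swapCopies G S y) z = ∑ z, edgeMult G S y z := by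
      rintro (⟨y, j⟩ | y)
      · right
        rw [sum_edgeMult_inl_eq_degree]
        exact sum_edgeMult_inl_eq_degree G S y (!j)
      · exact Or.inl rfl
    have hzero : oddExtension G S f (.inr b) = 0 := rfl
    rw [hzero, mul_zero]
    -- Reindexing by the exchange of copies shows that the sum equals its own negative.
    refine mul_eq_zero_of_right _ (self_eq_neg.mp ?_)
    rw [← Finset.sum_neg_distrib]
    conv_lhs => rw [← (swapCopies G S).sum_comp]
    refine Finset.sum_congr rfl fun y _ => ?_
    rw [edgeMult_inr_swapCopies, hodd]
    rcases hdeg y with h | h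
    · simp [h]
    · rw [h]
      ring

/-! ### Dirichlet eigenvalues -/

variable {G} [G.LocallyFinite]

/-- Maximum principle for `g = f / √d`: if `t ≤ 0`, a maximum of `|g|` spreads to all neighbours,
hence by connectedness to a boundary vertex, where `g` vanishes. -/
theorem pos_of_dirichlet_eigenvalue (hconn : G.Connected) {S : Finset V}
    (hS : (vertexBoundary G (S : Set V)).Nonempty) {f : V → ℂ} (hf : ∀ v ∉ S, f v = 0)
    (hne : f ≠ 0) {t : ℝ} (ht : ∀ v ∈ S, lapFun G f v = t * f v) : 0 < t := by
  obtain ⟨b, hb, b', hb', -⟩ := hS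
  have hnt : Nontrivial V := ⟨b, b', fun h => hb (h ▸ hb')⟩
  have hdeg : ∀ v, 0 < G.degree v := fun v => hconn.preconnected.degree_pos_of_nontrivial v
  have hsqrt : ∀ v, (Real.sqrt (G.degree v) : ℂ) ≠ 0 := fun v => by
    have := Real.sqrt_pos.mpr (Nat.cast_pos (α := ℝ).mpr (hdeg v))
    exact_mod_cast this.ne'
  set g : V → ℂ := fun v => f v / (Real.sqrt (G.degree v) : ℂ) with hg
  have hgS : ∀ v ∉ S, g v = 0 := fun v hv => by simp [hg, hf v hv]
  obtain ⟨m, hmS, hm⟩ := S.exists_max_image (fun v => ‖g v‖) ⟨b', hb'⟩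
  have hmax : ∀ v, ‖g v‖ ≤ ‖g m‖ := fun v => by
    by_cases hv : v ∈ S
    · exact hm v hv
    · rw [hgS v hv, norm_zero]
      exact norm_nonneg _
  have hmpos : 0 < ‖g m‖ := by
    obtain ⟨v, hv⟩ := Function.ne_iff.mp hne
    refine lt_of_lt_of_le ?_ (hmax v)
    exact norm_pos_iff.mpr (div_ne_zero hv (hsqrt v))
  by_contra! hneg
  have hstep : ∀ v ∈ S, ∑ u ∈ G.neighborFinset v, g u = ((1 - t) * G.degree v : ℝ) * g v := by
    intro v hv
    have h := ht v hv
    have hsq : (Real.sqrt (G.degree v) : ℂ) * (Real.sqrt (G.degree v) : ℂ) = G.degree v := by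
      rw [← Complex.ofReal_mul, Real.mul_self_sqrt (Nat.cast_nonneg _), Complex.ofReal_natCast]
    have hfv : f v = (Real.sqrt (G.degree v) : ℂ) * g v := by
      rw [hg]
      field_simp [hsqrt v]
    rw [lapFun, Finset.sum_sub_distrib, Finset.sum_const, SimpleGraph.card_neighborFinset_eq_degree,
      nsmul_eq_mul, one_div, inv_mul_eq_iff_eq_mul₀ (hsqrt v)] at h
    change (G.degree v : ℂ) * g v - ∑ u ∈ G.neighborFinset v, g u = _ at h
    rw [hfv] at h
    push_cast
    linear_combination -h - (t : ℂ) * g v * hsq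
  have hspread : ∀ v, ‖g v‖ = ‖g m‖ → ∀ u, G.Adj v u → ‖g u‖ = ‖g m‖ := by
    intro v hv u hu
    have hvS : v ∈ S := by
      by_contra h
      rw [hgS v h, norm_zero] at hv
      exact hmpos.ne hv
    by_contra hlt
    have h1 : ∑ w ∈ G.neighborFinset v, ‖g w‖ < ∑ w ∈ G.neighborFinset v, ‖g m‖ :=
      Finset.sum_lt_sum (fun w _ => hmax w) ⟨u, by simpa using hu, lt_of_le_of_ne (hmax u) hlt⟩
    have h2 := norm_sum_le (G.neighborFinset v) g
    rw [hstep v hvS, norm_mul, Complex.norm_real, hv] at h2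
    rw [Finset.sum_const, SimpleGraph.card_neighborFinset_eq_degree, nsmul_eq_mul] at h1
    have h3 := le_abs_self ((1 - t) * (G.degree v : ℝ))
    have h4 : (0 : ℝ) < G.degree v := Nat.cast_pos.mpr (hdeg v)
    rw [← Real.norm_eq_abs] at h3
    -- Here `t ≤ 0` enters: the neighbour sum has modulus at least `d(v)|g(m)|`, which a single
    -- smaller neighbour would make impossible.
    have h5 : (G.degree v : ℝ) ≤ (1 - t) * G.degree v := by nlinarith
    nlinarith
  have hall : ‖g b‖ = ‖g m‖ := by
    obtain ⟨p⟩ := hconn.preconnected m b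
    have : ∀ v w, G.Walk v w → ‖g v‖ = ‖g m‖ → ‖g w‖ = ‖g m‖ := by
      intro v w p
      induction p with
      | nil => exact id
      | cons h _ ih => exact fun hv => ih (hspread _ hv _ h)
    exact this m b p rfl
  rw [hgS b hb, norm_zero] at hall
  exact hmpos.ne hall

theorem lambdaOne_le_of_dirichlet_eigenvalue {S : Finset V} {f : V → ℂ}
    (hf : ∀ v ∉ S, f v = 0) (hne : f ≠ 0) {t : ℝ} (hpos : 0 < t)
    (ht : ∀ v ∈ S, lapFun G f v = t * f v) : lambdaOne G S ≤ t := by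
  refine csInf_le ⟨0, fun s hs => hs.1.le⟩ ⟨hpos, ?_⟩
  refine Module.End.hasEigenvalue_of_hasEigenvector (x := oddExtension G (S : Set V) f) ⟨?_, ?_⟩
  · rw [Module.End.mem_eigenspace_iff]
    exact multiLap_oddExtension G (S : Set V) f hf t ht
  · obtain ⟨v, hv⟩ := Function.ne_iff.mp hne
    have hvS : v ∈ S := by
      by_contra h
      exact hv (hf v h)
    refine Function.ne_iff.mpr ⟨.inl (⟨v, hvS⟩, true), ?_⟩
    simpa [oddExtension, copySign] using hv

/-- The minimum of the Rayleigh quotient over functions supported on `S` is attained at an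
eigenvector of the compressed Laplacian. This is a Dirichlet eigenfunction, so its eigenvalue is at
least `lambdaOne G S`. -/
theorem lambdaOne_mul_norm_sq_le (hconn : G.Connected) {S : Finset V}
    (hS : (vertexBoundary G (S : Set V)).Nonempty) {f : L2 V}
    (hf : f ∈ supportedOn (S : Set V)) :
    lambdaOne G S * ‖f‖ ^ 2 ≤ (inner ℂ (lap G f) f).re := by
  classical
  rcases eq_or_ne f 0 with rfl | hne
  · simp
  set K := supportedOn (S : Set V) with hK
  set T : K →ₗ[ℂ] K := ((K.orthogonalProjectionOnto ∘L lap G ∘L K.subtypeL : K →L[ℂ] K) : K →ₗ[ℂ] K)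
    with hTdef
  have hTinner : ∀ x y : K, inner ℂ (T x) y = inner ℂ (lap G x) (y : L2 V) := fun x y =>
    Submodule.inner_orthogonalProjectionOnto_eq_of_mem_right y (lap G x)
  have hsymm := (lap_isSelfAdjoint G).isSymmetric
  have hT : T.IsSymmetric := by
    intro x y
    rw [hTinner, ← inner_conj_symm x, hTinner, inner_conj_symm]
    exact hsymm x y
  have hnt : Nontrivial K := ⟨⟨f, hf⟩, 0, fun h => hne (congr_arg Subtype.val h)⟩
  have hev := hT.hasEigenvalue_iInf_of_finiteDimensional
  set t := ⨅ x : { x : K // x ≠ 0 }, RCLike.re (inner ℂ (T x) (x : K)) / ‖(x : K)‖ ^ 2 with ht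
  obtain ⟨φ, hφ⟩ := hev.exists_hasEigenvector
  -- Testing the eigenvector equation of the compression against the point mass at `v` recovers the
  -- pointwise equation on `S`.
  have hφt : ∀ v ∈ S, lapFun G (φ : L2 V) v = t * (φ : L2 V) v := by
    intro v hv
    have he : lp.single 2 v (1 : ℂ) ∈ K := fun w hw => by
      have : w ≠ v := fun h => hw (h ▸ hv)
      simp [lp.single_apply, this]
    have h := hTinner φ ⟨_, he⟩
    rw [hφ.apply_eq_smul, Submodule.coe_inner, Submodule.coe_smul, ← inner_conj_symm,
      ← inner_conj_symm (lap G φ), lp.inner_single_left, lp.inner_single_left] at h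
    have h' := (starRingEnd ℂ).injective h
    simp only [RCLike.inner_apply, map_one, mul_one] at h'
    exact h'.symm
  have hφ0 : ((φ : L2 V) : V → ℂ) ≠ 0 := fun h => hφ.2 (Subtype.ext (lp.ext h))
  have hpos := pos_of_dirichlet_eigenvalue hconn hS φ.2 hφ0 hφt
  have hle := lambdaOne_le_of_dirichlet_eigenvalue φ.2 hφ0 hpos hφt
  have hbdd : BddBelow (Set.range fun x : { x : K // x ≠ 0 } =>
      RCLike.re (inner ℂ (T x) (x : K)) / ‖(x : K)‖ ^ 2) := by
    refine ⟨-‖lap G‖, ?_⟩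
    rintro _ ⟨⟨x, hx⟩, rfl⟩
    have hxpos : 0 < ‖x‖ ^ 2 := by positivity
    rw [le_div_iff₀ hxpos, hTinner]
    have h1 := abs_le.mp (RCLike.abs_re_le_norm (inner ℂ (lap G x) (x : L2 V)))
    have h2 := norm_inner_le_norm (𝕜 := ℂ) (lap G x) (x : L2 V)
    have h3 := (lap G).le_opNorm x
    have h4 : ‖(x : L2 V)‖ = ‖x‖ := rfl
    rw [h4] at h2 h3
    nlinarith [norm_nonneg x, h1.1]
  have hray := ciInf_le hbdd ⟨⟨f, hf⟩, fun h => hne (congr_arg Subtype.val h)⟩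
  have hfpos : 0 < ‖f‖ ^ 2 := by positivity
  rw [← ht] at hray
  simp only [hTinner] at hray
  have h := hle.trans hray
  rwa [show ‖(⟨f, hf⟩ : K)‖ = ‖f‖ from rfl, le_div_iff₀ hfpos] at h

end Dirichlet

/-! ### Unions of finite sets with disjoint closures -/

section Disjoint

variable {V : Type*} {G : SimpleGraph V} [G.LocallyFinite] {ι : Type*} {S : ι → Finset V}

theorem lap_norm_le : ‖lap G‖ ≤ 2 := LinearMap.mkContinuous_norm_le _ (by norm_num) _

theorem L2_hasSum_re_inner (f g : L2 V) :
    HasSum (fun v => (inner ℂ (f v) (g v)).re) (inner ℂ f g).re :=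
  Complex.hasSum_re (lp.hasSum_inner f g)

/-- Disjointness of the closures makes `f` vanish on `bS_j`. So `f` and its cutoff to `S_j` agree on
`S_j ∪ bS_j`, which is all that the Laplacian sees at points of `S_j`. -/
theorem lambdaOne_mul_sum_le (hconn : G.Connected)
    (hbdry : ∀ j, (vertexBoundary G (S j : Set V)).Nonempty)
    (hdisj : Pairwise fun i j =>
      Disjoint (vertexClosure G (S i : Set V)) (vertexClosure G (S j : Set V)))
    {f : L2 V} (hf : f ∈ supportedOn (⋃ j, (S j : Set V))) (j : ι) :
    lambdaOne G (S j) * ∑ v ∈ S j, ‖f v‖ ^ 2 ≤ ∑ v ∈ S j, (inner ℂ (lap G f v) (f v)).re := by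
  set g := cutoff (S j : Set V) f with hg
  have hgf : ∀ v ∈ vertexClosure G (S j : Set V), g v = f v := by
    intro v hv
    by_cases hvS : v ∈ (S j : Set V)
    · exact cutoff_of_mem f hvS
    · rw [hg, cutoff_of_notMem f hvS, hf v]
      rw [Set.mem_iUnion]
      rintro ⟨i, hi⟩
      have hij : i ≠ j := by
        rintro rfl
        exact hvS hi
      exact Set.disjoint_left.mp (hdisj hij) (Or.inl hi) hv
  have hsupp : g ∈ supportedOn (S j : Set V) := cutoff_mem_supportedOn _ f
  have h := lambdaOne_mul_norm_sq_le hconn (hbdry j) hsupp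
  have h1 : ‖g‖ ^ 2 = ∑ v ∈ S j, ‖f v‖ ^ 2 := by
    refine (L2_hasSum_norm_sq g).unique ?_
    have : ∀ v ∈ S j, ‖f v‖ ^ 2 = ‖g v‖ ^ 2 := fun v hv => by rw [hgf v (Or.inl hv)]
    rw [Finset.sum_congr rfl this]
    exact hasSum_sum_of_ne_finset_zero fun v hv => by
      rw [hsupp v hv, norm_zero, sq, mul_zero]
  have h2 : (inner ℂ (lap G g) g).re = ∑ v ∈ S j, (inner ℂ (lap G f v) (f v)).re := by
    refine (L2_hasSum_re_inner (lap G g) g).unique ?_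
    have : ∀ v ∈ S j, (inner ℂ (lap G f v) (f v)).re = (inner ℂ (lap G g v) (g v)).re := by
      intro v hv
      rw [hgf v (Or.inl hv), lap_apply, lap_apply, hgf v (Or.inl hv)]
      congr 3
      refine Finset.sum_congr rfl fun u hu => ?_
      rw [hgf u (mem_vertexClosure_of_adj G hv (by simpa using hu))]
    rw [Finset.sum_congr rfl this]
    exact hasSum_sum_of_ne_finset_zero fun v hv => by
      rw [hsupp v hv, inner_zero_right, Complex.zero_re]
  rwa [h1, h2] at h

theorem hasSum_norm_sq_of_mem_supportedOn (hS : Pairwise fun i j => Disjoint (S i) (S j))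
    {f : L2 V} (hf : f ∈ supportedOn (⋃ j, (S j : Set V))) :
    HasSum (fun j => ∑ v ∈ S j, ‖f v‖ ^ 2) (‖f‖ ^ 2) :=
  hasSum_sum_of_pairwise_disjoint hS (fun v hv => by simp [hf v hv]) (L2_hasSum_norm_sq f)

theorem hasSum_re_inner_of_mem_supportedOn (hS : Pairwise fun i j => Disjoint (S i) (S j))
    {f : L2 V} (hf : f ∈ supportedOn (⋃ j, (S j : Set V))) :
    HasSum (fun j => ∑ v ∈ S j, (inner ℂ (lap G f v) (f v)).re) (inner ℂ (lap G f) f).re :=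
  hasSum_sum_of_pairwise_disjoint hS (fun v hv => by simp [hf v hv])
    (L2_hasSum_re_inner (lap G f) f)

theorem mul_norm_sq_le_of_le_lambdaOne (hconn : G.Connected)
    (hbdry : ∀ j, (vertexBoundary G (S j : Set V)).Nonempty)
    (hdisj : Pairwise fun i j =>
      Disjoint (vertexClosure G (S i : Set V)) (vertexClosure G (S j : Set V)))
    {c : ℝ} (hc : ∀ j, c ≤ lambdaOne G (S j))
    {f : L2 V} (hf : f ∈ supportedOn (⋃ j, (S j : Set V))) :
    c * ‖f‖ ^ 2 ≤ (inner ℂ (lap G f) f).re := by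
  have hS := pairwise_disjoint_of_closures hdisj
  refine hasSum_le (fun j => ?_) ((hasSum_norm_sq_of_mem_supportedOn hS hf).mul_left c)
    (hasSum_re_inner_of_mem_supportedOn hS hf)
  refine le_trans ?_ (lambdaOne_mul_sum_le hconn hbdry hdisj hf j)
  exact mul_le_mul_of_nonneg_right (hc j) (Finset.sum_nonneg fun _ _ => by positivity)

/-- No uniform gap is needed: the local inequalities are all weak, and the one on a set `S_j` where
`f` is nonzero is strict, which makes the summed inequality strict. -/
theorem eq_zero_of_mem_PW_of_mem_supportedOn (hconn : G.Connected)
    (hbdry : ∀ j, (vertexBoundary G (S j : Set V)).Nonempty)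
    (hdisj : Pairwise fun i j =>
      Disjoint (vertexClosure G (S i : Set V)) (vertexClosure G (S j : Set V)))
    {ω : ℝ} (hlam : ∀ j, ω < lambdaOne G (S j)) {f : L2 V} (hPW : f ∈ PW G ω)
    (hf : f ∈ supportedOn (⋃ j, (S j : Set V))) : f = 0 := by
  have hS := pairwise_disjoint_of_closures hdisj
  by_contra hne
  have hle := re_inner_le_of_mem_spectralSubspace (lap_isSelfAdjoint G) hPW
  have hterm : ∀ j, ω * ∑ v ∈ S j, ‖f v‖ ^ 2 ≤ ∑ v ∈ S j, (inner ℂ (lap G f v) (f v)).re :=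
    fun j => le_trans (mul_le_mul_of_nonneg_right (hlam j).le
      (Finset.sum_nonneg fun _ _ => by positivity)) (lambdaOne_mul_sum_le hconn hbdry hdisj hf j)
  obtain ⟨v, hv⟩ : ∃ v, f v ≠ 0 := by
    by_contra! h
    exact hne (lp.ext (funext h))
  obtain ⟨j, hj⟩ : ∃ j, v ∈ S j := by
    by_contra h
    exact hv (hf v (by simpa using h))
  have hpos : 0 < ∑ w ∈ S j, ‖f w‖ ^ 2 :=
    Finset.sum_pos' (fun _ _ => by positivity) ⟨v, hj, by positivity⟩
  have hlt := hasSum_lt hterm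
    ((mul_lt_mul_of_pos_right (hlam j) hpos).trans_le (lambdaOne_mul_sum_le hconn hbdry hdisj hf j))
    ((hasSum_norm_sq_of_mem_supportedOn hS hf).mul_left ω)
    (hasSum_re_inner_of_mem_supportedOn hS hf)
  exact absurd hle (not_le.mpr hlt)

/-- Write `f = p + q` with `q` the part on the complement. Then `c‖p‖² ≤ ⟨Lp, p⟩`, and replacing `p`
by `f - q` leaves `⟨Lf, f⟩ ≤ ω‖f‖²` plus three terms containing `q`. Each is at most `2‖f‖‖q‖` as
`‖L‖ ≤ 2`, whence the 6; the `|c|` comes from `c‖p‖² = c‖f‖² - c‖q‖²`. -/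
theorem norm_le_of_mem_PW (hconn : G.Connected)
    (hbdry : ∀ j, (vertexBoundary G (S j : Set V)).Nonempty)
    (hdisj : Pairwise fun i j =>
      Disjoint (vertexClosure G (S i : Set V)) (vertexClosure G (S j : Set V)))
    {ω c : ℝ} (hωc : ω < c) (hc : ∀ j, c ≤ lambdaOne G (S j)) {f : L2 V} (hPW : f ∈ PW G ω) :
    ‖f‖ ≤ (6 + |c|) / (c - ω) * ‖restrict (⋃ j, (S j : Set V))ᶜ f‖ := by
  set A := ⋃ j, (S j : Set V)
  rw [← norm_cutoff]
  set p := cutoff A f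
  set q := cutoff Aᶜ f
  have hsplit : p = f - q := eq_sub_of_add_eq (cutoff_add_cutoff_compl A f)
  have hnorm : ‖f‖ ^ 2 = ‖p‖ ^ 2 + ‖q‖ ^ 2 := norm_sq_cutoff_add A f
  have h1 := mul_norm_sq_le_of_le_lambdaOne hconn hbdry hdisj hc (cutoff_mem_supportedOn A f)
  have h2 := re_inner_le_of_mem_spectralSubspace (lap_isSelfAdjoint G) hPW
  have hbound : ∀ x y : L2 V, |(inner ℂ (lap G x) y).re| ≤ 2 * ‖x‖ * ‖y‖ := fun x y =>
    (Complex.abs_re_le_norm _).trans <| (norm_inner_le_norm _ _).trans <|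
      mul_le_mul_of_nonneg_right ((lap G).le_of_opNorm_le lap_norm_le x) (norm_nonneg y)
  have h3 : (inner ℂ (lap G p) p).re = (inner ℂ (lap G f) f).re - (inner ℂ (lap G f) q).re -
      (inner ℂ (lap G q) f).re + (inner ℂ (lap G q) q).re := by
    rw [hsplit, map_sub, inner_sub_left, inner_sub_right, inner_sub_right]
    simp only [Complex.sub_re]
    ring
  have h4 := abs_le.mp (hbound f q)
  have h5 := abs_le.mp (hbound q f)
  have h6 := abs_le.mp (hbound q q)
  change c * ‖p‖ ^ 2 ≤ (inner ℂ (lap G p) p).re at h1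
  have hq : ‖q‖ ≤ ‖f‖ := by
    refine (sq_le_sq₀ (norm_nonneg _) (norm_nonneg _)).mp ?_
    nlinarith [sq_nonneg ‖p‖]
  have hqq : ‖q‖ * ‖q‖ ≤ ‖f‖ * ‖q‖ := mul_le_mul_of_nonneg_right hq (norm_nonneg q)
  have hcq : c * ‖q‖ ^ 2 ≤ |c| * (‖f‖ * ‖q‖) := by
    rw [sq]
    exact (mul_le_mul_of_nonneg_right (le_abs_self c) (by positivity)).trans
      (mul_le_mul_of_nonneg_left hqq (abs_nonneg c))
  have hp : c * ‖p‖ ^ 2 = c * ‖f‖ ^ 2 - c * ‖q‖ ^ 2 := by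
    rw [hnorm]
    ring
  have hmain : (c - ω) * ‖f‖ * ‖f‖ ≤ (6 + |c|) * ‖q‖ * ‖f‖ := by
    linarith [h4.1, h5.1, h6.2]
  rcases (norm_nonneg f).eq_or_lt with h0 | h0
  · rw [← h0]
    have : 0 < c - ω := sub_pos.mpr hωc
    positivity
  · rw [div_mul_eq_mul_div, le_div_iff₀ (sub_pos.mpr hωc), mul_comm]
    exact le_of_mul_le_mul_right hmain h0

end Disjoint

end GraphPW

/-! ### The main theorem -/

theorem theorem1p2 {V : Type*} (G : SimpleGraph V) [G.LocallyFinite] (hconn : G.Connected)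
    (hdeg : BddAbove (Set.range fun v => G.degree v))
    (ω : ℝ) (hω : GraphPW.omegaMin G < ω) (hωΩ : ω < GraphPW.OmegaG G)
    {ι : Type*} (S : ι → Finset V)
    (hbdry : ∀ j, (GraphPW.vertexBoundary G (S j : Set V)).Nonempty)
    (hlam : ∀ j, ω < GraphPW.lambdaOne G (S j))
    (hdisj : Pairwise fun i j =>
      Disjoint (GraphPW.vertexClosure G (S i : Set V)) (GraphPW.vertexClosure G (S j : Set V)))
    (U : Set V) (hU : U = (⋃ j, (S j : Set V))ᶜ) :
    GraphPW.IsUniquenessSet G U ω ∧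
    ((FiniteDimensional ℂ (GraphPW.PW G ω) ∨ ∃ c, ω < c ∧ ∀ j, c ≤ GraphPW.lambdaOne G (S j)) →
      ∃ Θ : U → GraphPW.PW G ω, GraphPW.IsFrame Θ ∧
        ∀ f ∈ GraphPW.PW G ω, ∀ v : V,
          HasSum (fun u : U => f u * (Θ u : GraphPW.L2 V) v) (f v)) := by
  have huniq : GraphPW.IsUniquenessSet G U ω := by
    intro f hf g hg hfg
    refine sub_eq_zero.mp (GraphPW.eq_zero_of_mem_PW_of_mem_supportedOn hconn hbdry hdisj hlam
      (Submodule.sub_mem _ hf hg) fun v hv => ?_)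
    rw [lp.coeFn_sub, Pi.sub_apply, hfg v (hU ▸ hv), sub_self]
  refine ⟨huniq, fun h => ?_⟩
  have : CompleteSpace (GraphPW.PW G ω) :=
    (GraphPW.isClosed_spectralSubspace (GraphPW.lap G) (Set.Icc 0 ω)).completeSpace_coe
  set R : GraphPW.PW G ω →L[ℂ] GraphPW.L2 U :=
    GraphPW.restrict U ∘L (GraphPW.PW G ω).subtypeL with hR
  obtain ⟨K, hK⟩ : ∃ K, AntilipschitzWith K R := by
    rcases h with h | ⟨c, hωc, hc⟩
    · obtain ⟨K, -, hK⟩ := LinearMap.exists_antilipschitzWith (R : GraphPW.PW G ω →ₗ[ℂ] _)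
        (LinearMap.ker_eq_bot.mpr fun f g hfg => Subtype.ext (huniq f f.2 g g.2 fun u hu =>
          congr_arg (fun h : GraphPW.L2 U => h ⟨u, hu⟩) hfg))
      exact ⟨K, hK⟩
    · subst hU
      have h0 : 0 ≤ (6 + |c|) / (c - ω) := div_nonneg (by positivity) (sub_pos.mpr hωc).le
      exact ⟨⟨_, h0⟩, ContinuousLinearMap.antilipschitz_of_bound R fun f =>
        GraphPW.norm_le_of_mem_PW hconn hbdry hdisj hωc hc f.2⟩
  obtain ⟨Θ, hΘ, hsum⟩ := GraphPW.exists_frame_of_antilipschitz R hK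
  refine ⟨Θ, hΘ, fun f hf v => ?_⟩
  -- Evaluation at `v` is continuous, so convergence in norm gives the pointwise expansion.
  exact (hsum ⟨f, hf⟩).mapL (lp.evalCLM ℂ (fun _ : V => ℂ) 2 v ∘L (GraphPW.PW G ω).subtypeL)

end
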